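/- All cohomology is simplicial cohomology with coefficients in $\mathbb{Z}/2$. For a finite simplicial complex $K$ and a partition $\lambda_q=\{s_1\le s_2\le\dots\le s_\ell\}$ of an integer $q\ge 0$ (a multiset of positive integers with sum $q$), put $$\operatorname{im} H^{\lambda_q}(\smile K)=\big\langle \alpha_1\smile\alpha_2\smile\dots\smile\alpha_\ell \;\big|\; \alpha_j\in H^{s_j}(K),\ 1\le j\le \ell\big\rangle\subseteq H^q(K),$$ the linear span of the products (the empty product being $1\in H^0(K)$). For a filtration $K_\bullet=(K_a)_{a\in\mathbb{R}}$ of simplicial complexes, $K_a\subseteq K_b$ for $a\le b$, the *partition module* $\operatorname{im} H^{\lambda_q}(\smile K_\bullet)$ is the persistence module with spaces $\operatorname{im} H^{\lambda_q}(\smile K_a)$ and with structure maps $\operatorname{im} H^{\lambda_q}(\smile K_b)\to \operatorname{im} H^{\lambda_q}(\smile K_a)$, $a\le b$, the restrictions of the maps $H^q(K_b)\to H^q(K_a)$ induced by inclusion. For two such persistence modules $M,N$ and $\varepsilon\ge 0$, an $\varepsilon$-interleaving consists of linear maps $F_a:M_{a+\varepsilon}\to N_a$ and $G_a:N_{a+\varepsilon}\to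 M_a$ for $a\in\mathbb{R}$, commuting with the structure maps, such that $G_a\circ F_{a+\varepsilon}$ and $F_a\circ G_{a+\varepsilon}$ are the structure maps $M_{a+2\varepsilon}\to M_a$ and $N_{a+2\varepsilon}\to N_a$; the interleaving distance $d_I(M,N)\in[0,\infty]$ is the infimum of all $\varepsilon\ge 0$ for which an $\varepsilon$-interleaving exists. For a finite set $X\subset\mathbb{R}^d$ with the Euclidean metric, the Rips and Čech filtrations are $$\mathrm{Rips}_t(X)=\{\emptyset\ne S\subseteq X \mid \operatorname{diam} S\le t\},\qquad \check{\mathrm{C}}\mathrm{ech}_r(X)=\Big\{\emptyset\ne S\subseteq X \;\Big|\; \bigcap_{x\in S}D_{r,x}\ne\emptyset\Big\},$$ where $D_{r,x}\subset\mathbb{R}^d$ is the closed Euclidean ball of radius $r$ around $x$ (so both complexes are empty for negative parameters). Let $d_H$ be the Hausdorff distance in $\mathbb{R}^d$, and let $d_{GH}(X,Y)$ be the Gromov–Hausdorff distance: the infimum of $d_H(f(X),g(Y))$ over all isometric embeddings $f:X\hookrightarrow M$, $g:Y\hookrightarrow M$ into a common metric space $M$. **Theorem.** Let $\lambda_q$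 be a partition of an integer $q$. Then for all finite point sets $X,Y\subset\mathbb{R}^d$, $$\tfrac12\, d_I\big(\operatorname{im} H^{\lambda_q}(\smile \mathrm{Rips}_\bullet(X)),\ \operatorname{im} H^{\lambda_q}(\smile \mathrm{Rips}_\bullet(Y))\big)\le d_{GH}(X,Y),$$ $$\tfrac12\, d_I\big(\operatorname{im} H^{\lambda_q}(\smile \check{\mathrm{C}}\mathrm{ech}_\bullet(X)),\ \operatorname{im} H^{\lambda_q}(\smile \check{\mathrm{C}}\mathrm{ech}_\bullet(Y))\big)\le d_{H}(X,Y).$$ -/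

import Mathlib

open CategoryTheory
open scoped NNReal ENNReal

noncomputable section

namespace PartitionModules

/-! ### Simplicial cochains and cohomology with coefficients in `ZMod 2`

A simplicial complex on a vertex type `V` is Mathlib's `PreAbstractSimplicialComplex V`: a
downward closed family of nonempty finite subsets of `V` (not every `v : V` has to be a vertex). -/

section Cohomology

variable {V : Type}

/-- The `p`-simplices of `K`: its faces with `p + 1` vertices. -/
def Simplex (K : PreAbstractSimplicialComplex V) (p : ℕ) : Type :=
  {σ : Finset V // σ ∈ K ∧ σ.card = p + 1}

/-- The space `C^p(K)` of simplicial `p`-cochains mod 2. -/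
abbrev Cochain (K : PreAbstractSimplicialComplex V) (p : ℕ) : Type :=
  Simplex K p → ZMod 2

variable {K : PreAbstractSimplicialComplex V}

theorem face_mem {σ τ : Finset V} (hσ : σ ∈ K) (hτ : τ ⊆ σ) (hne : τ.Nonempty) : τ ∈ K :=
  (K.isRelLowerSet_faces hσ).2 hτ hne

/-- Extension of a cochain by zero to all finite sets (auxiliary, for computations). -/
def ext0 {p : ℕ} (c : Cochain K p) (τ : Finset V) : ZMod 2 :=
  open Classical in if h : τ ∈ K ∧ τ.card = p + 1 then c ⟨τ, h⟩ else 0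

theorem ext0_val {p : ℕ} (c : Cochain K p) (σ : Simplex K p) : ext0 c σ.1 = c σ := by
  unfold ext0
  rw [dif_pos σ.2]
  rfl

variable [LinearOrder V]

/-- The facet of a simplex opposite to one of its vertices. -/
def Simplex.facet {p : ℕ} (σ : Simplex K (p + 1)) (v : {v // v ∈ σ.1}) : Simplex K p :=
  ⟨σ.1.erase v.1,
    face_mem σ.2.1 (Finset.erase_subset _ _)
      (Finset.card_pos.1 (by rw [Finset.card_erase_of_mem v.2, σ.2.2]; omega)),
    by rw [Finset.card_erase_of_mem v.2, σ.2.2]; omega⟩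

/-- The coboundary `δ : C^p(K) → C^{p+1}(K)`: the sum of the values on all facets. -/
def coboundary (K : PreAbstractSimplicialComplex V) (p : ℕ) :
    Cochain K p →ₗ[ZMod 2] Cochain K (p + 1) where
  toFun c := fun σ => ∑ v ∈ σ.1.attach, c (σ.facet v)
  map_add' a b := by
    funext σ
    simp [Finset.sum_add_distrib]
  map_smul' r a := by
    funext σ
    simp [Finset.mul_sum]

/-- The `p`-cocycles. -/
def cocycles (K : PreAbstractSimplicialComplex V) (p : ℕ) : Submodule (ZMod 2) (Cochain K p) :=
  LinearMap.ker (coboundary K p)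

/-- The `p`-coboundaries. -/
def coboundaries (K : PreAbstractSimplicialComplex V) :
    (p : ℕ) → Submodule (ZMod 2) (Cochain K p)
  | 0 => ⊥
  | p + 1 => LinearMap.range (coboundary K p)

/-- The cohomology `H^p(K) = Z^p(K) / B^p(K)` mod 2. -/
abbrev Cohomology (K : PreAbstractSimplicialComplex V) (p : ℕ) : Type :=
  (cocycles K p) ⧸ (coboundaries K p).submoduleOf (cocycles K p)

/-- The class of a cocycle. -/
def cls {p : ℕ} (z : cocycles K p) : Cohomology K p := Submodule.Quotient.mk z

/-! ### The cup product -/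

/-- The position (starting at `0`) of `v` in the increasing list of the elements of `σ`. -/
def rank (σ : Finset V) (v : V) : ℕ := (σ.filter (· < v)).card

/-- The vertices `v₀, …, v_p` of `σ = {v₀ < v₁ < …}`. -/
def front (σ : Finset V) (p : ℕ) : Finset V := σ.filter (fun v => rank σ v ≤ p)

/-- The vertices `v_p, v_{p+1}, …` of `σ = {v₀ < v₁ < …}`. -/
def back (σ : Finset V) (p : ℕ) : Finset V := σ.filter (fun v => p ≤ rank σ v)

theorem rank_lt_rank {σ : Finset V} {v w : V} (hv : v ∈ σ) (h : v < w) :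
    rank σ v < rank σ w := by
  refine Finset.card_lt_card (Finset.ssubset_iff_of_subset ?_ |>.2 ⟨v, ?_, ?_⟩)
  · intro x hx
    simp only [Finset.mem_filter] at hx ⊢
    exact ⟨hx.1, hx.2.trans h⟩
  · simp [hv, h]
  · simp

theorem rank_injOn (σ : Finset V) : Set.InjOn (rank σ) σ := by
  intro v hv w hw h
  rcases lt_trichotomy v w with hlt | heq | hgt
  · exact absurd h (rank_lt_rank hv hlt).ne
  · exact heq
  · exact absurd h (rank_lt_rank hw hgt).ne'

theorem rank_lt_card {σ : Finset V} {v : V} (hv : v ∈ σ) : rank σ v < σ.card :=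
  Finset.card_lt_card (Finset.ssubset_iff_of_subset (Finset.filter_subset _ _) |>.2
    ⟨v, hv, by simp⟩)

theorem image_rank (σ : Finset V) : σ.image (rank σ) = Finset.range σ.card := by
  refine Finset.eq_of_subset_of_card_le ?_ ?_
  · intro n hn
    obtain ⟨v, hv, rfl⟩ := Finset.mem_image.1 hn
    exact Finset.mem_range.2 (rank_lt_card hv)
  · rw [Finset.card_range, Finset.card_image_of_injOn (rank_injOn σ)]

theorem card_filter_rank (σ : Finset V) (P : ℕ → Prop) [DecidablePred P] :
    (σ.filter (fun v => P (rank σ v))).card = ((Finset.range σ.card).filter P).card := by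
  rw [← image_rank, Finset.filter_image, Finset.card_image_of_injOn]
  exact (rank_injOn σ).mono (Finset.coe_subset.2 (Finset.filter_subset _ _))

theorem card_front {σ : Finset V} {p : ℕ} (h : p < σ.card) : (front σ p).card = p + 1 := by
  rw [front, card_filter_rank σ (fun i => i ≤ p)]
  have : (Finset.range σ.card).filter (fun i => i ≤ p) = Finset.range (p + 1) := by
    ext i; simp; omega
  rw [this, Finset.card_range]

theorem card_back (σ : Finset V) (p : ℕ) : (back σ p).card = σ.card - p := by
  rw [back, card_filter_rank σ (fun i => p ≤ i)]
  have : (Finset.range σ.card).filter (fun i => p ≤ i) = Finset.Ico p σ.card := by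
    ext i; simp; omega
  rw [this, Nat.card_Ico]

/-- The front `p`-face `{v₀, …, v_p}` of an `n`-simplex `{v₀ < … < v_n}`, `n = p + q`. -/
def Simplex.frontFace {p q n : ℕ} (h : p + q = n) (σ : Simplex K n) : Simplex K p :=
  ⟨front σ.1 p,
    face_mem σ.2.1 (Finset.filter_subset _ _)
      (Finset.card_pos.1 (by rw [card_front (by rw [σ.2.2]; omega)]; omega)),
    card_front (by rw [σ.2.2]; omega)⟩

/-- The back `q`-face `{v_p, …, v_n}` of an `n`-simplex `{v₀ < … < v_n}`, `n = p + q`. -/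
def Simplex.backFace {p q n : ℕ} (h : p + q = n) (σ : Simplex K n) : Simplex K q :=
  ⟨back σ.1 p,
    face_mem σ.2.1 (Finset.filter_subset _ _)
      (Finset.card_pos.1 (by rw [card_back, σ.2.2]; omega)),
    by rw [card_back, σ.2.2]; omega⟩

/-- The cup product of cochains,
`(a ⌣ b){v₀ < … < v_{p+q}} = a{v₀, …, v_p} · b{v_p, …, v_{p+q}}`. -/
def cupCochain {p q n : ℕ} (h : p + q = n) (a : Cochain K p) (b : Cochain K q) : Cochain K n :=
  fun σ => a (σ.frontFace h) * b (σ.backFace h)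

theorem cupCochain_sub_left {p q n : ℕ} (h : p + q = n) (a a' : Cochain K p) (b : Cochain K q) :
    cupCochain h (a - a') b = cupCochain h a b - cupCochain h a' b := by
  funext σ; simp [cupCochain, sub_mul]

theorem cupCochain_sub_right {p q n : ℕ} (h : p + q = n) (a : Cochain K p) (b b' : Cochain K q) :
    cupCochain h a (b - b') = cupCochain h a b - cupCochain h a b' := by
  funext σ; simp [cupCochain, mul_sub]

theorem coboundary_apply {p : ℕ} (c : Cochain K p) (σ : Simplex K (p + 1)) :
    coboundary K p c σ = ∑ v ∈ σ.1, ext0 c (σ.1.erase v) := by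
  rw [← Finset.sum_attach]
  exact Finset.sum_congr rfl fun v _ => (ext0_val c (σ.facet v)).symm

theorem rank_erase_of_le {σ : Finset V} {v w : V} (h : w ≤ v) :
    rank (σ.erase v) w = rank σ w := by
  unfold rank
  congr 1
  ext x
  simp only [Finset.mem_filter, Finset.mem_erase]
  constructor
  · rintro ⟨⟨-, h1⟩, h2⟩; exact ⟨h1, h2⟩
  · rintro ⟨h1, h2⟩; exact ⟨⟨(h2.trans_le h).ne, h1⟩, h2⟩

theorem rank_erase_of_lt {σ : Finset V} {v w : V} (hv : v ∈ σ) (h : v < w) :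
    rank (σ.erase v) w + 1 = rank σ w := by
  unfold rank
  rw [Finset.filter_erase, Finset.card_erase_add_one (by simp [hv, h])]

theorem front_erase_of_le {σ : Finset V} {v : V} (hv : v ∈ σ) {p : ℕ} (h : rank σ v ≤ p + 1) :
    front (σ.erase v) p = (front σ (p + 1)).erase v := by
  ext w
  simp only [front, Finset.mem_filter, Finset.mem_erase]
  rcases lt_trichotomy v w with hlt | rfl | hgt
  · have := rank_erase_of_lt hv hlt
    have h2 := hlt.ne'
    constructor
    · rintro ⟨⟨a, b⟩, c⟩; exact ⟨a, b, by omega⟩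
    · rintro ⟨a, b, c⟩; exact ⟨⟨a, b⟩, by omega⟩
  · simp
  · rw [rank_erase_of_le hgt.le]
    constructor
    · rintro ⟨⟨a, b⟩, c⟩; exact ⟨a, b, by omega⟩
    · rintro ⟨a, b, c⟩
      have := rank_lt_rank b hgt
      exact ⟨⟨a, b⟩, by omega⟩

theorem back_erase_of_le {σ : Finset V} {v : V} (hv : v ∈ σ) {p : ℕ} (h : rank σ v ≤ p) :
    back (σ.erase v) p = back σ (p + 1) := by
  ext w
  simp only [back, Finset.mem_filter, Finset.mem_erase]
  rcases lt_trichotomy v w with hlt | rfl | hgt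
  · have := rank_erase_of_lt hv hlt
    constructor
    · rintro ⟨⟨a, b⟩, c⟩; exact ⟨b, by omega⟩
    · rintro ⟨b, c⟩; exact ⟨⟨hlt.ne', b⟩, by omega⟩
  · constructor
    · rintro ⟨⟨a, b⟩, c⟩; exact absurd rfl a
    · rintro ⟨b, c⟩; omega
  · rw [rank_erase_of_le hgt.le]
    constructor
    · rintro ⟨⟨a, b⟩, c⟩
      have := rank_lt_rank b hgt
      omega
    · rintro ⟨b, c⟩
      have := rank_lt_rank b hgt
      omega

theorem front_erase_of_lt {σ : Finset V} {v : V} (hv : v ∈ σ) {p : ℕ} (h : p < rank σ v) :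
    front (σ.erase v) p = front σ p := by
  ext w
  simp only [front, Finset.mem_filter, Finset.mem_erase]
  rcases lt_trichotomy v w with hlt | rfl | hgt
  · have := rank_erase_of_lt hv hlt
    have := rank_lt_rank hv hlt
    constructor
    · rintro ⟨⟨a, b⟩, c⟩; omega
    · rintro ⟨b, c⟩; omega
  · constructor
    · rintro ⟨⟨a, b⟩, c⟩; exact absurd rfl a
    · rintro ⟨b, c⟩; omega
  · rw [rank_erase_of_le hgt.le]
    constructor
    · rintro ⟨⟨a, b⟩, c⟩; exact ⟨b, c⟩
    · rintro ⟨b, c⟩; exact ⟨⟨hgt.ne, b⟩, c⟩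

theorem back_erase_of_le_rank {σ : Finset V} {v : V} (hv : v ∈ σ) {p : ℕ} (h : p ≤ rank σ v) :
    back (σ.erase v) p = (back σ p).erase v := by
  ext w
  simp only [back, Finset.mem_filter, Finset.mem_erase]
  rcases lt_trichotomy v w with hlt | rfl | hgt
  · have := rank_erase_of_lt hv hlt
    have := rank_lt_rank hv hlt
    constructor
    · rintro ⟨⟨a, b⟩, c⟩; exact ⟨a, b, by omega⟩
    · rintro ⟨a, b, c⟩; exact ⟨⟨a, b⟩, by omega⟩
  · simp
  · rw [rank_erase_of_le hgt.le]
    exact and_assoc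

/-- Mod 2 Leibniz rule. -/
theorem coboundary_cupCochain {p q n : ℕ} (h : p + q = n) (a : Cochain K p) (b : Cochain K q) :
    coboundary K n (cupCochain h a b) =
      cupCochain (by omega : (p + 1) + q = n + 1) (coboundary K p a) b +
        cupCochain (by omega : p + (q + 1) = n + 1) a (coboundary K q b) := by
  funext σ
  have h1 : (p + 1) + q = n + 1 := by omega
  have h2 : p + (q + 1) = n + 1 := by omega
  obtain ⟨v1, hv1, r1⟩ : ∃ v ∈ σ.1, rank σ.1 v = p + 1 := by
    have : p + 1 ∈ σ.1.image (rank σ.1) := by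
      rw [image_rank, σ.2.2]; exact Finset.mem_range.2 (by omega)
    simpa using this
  obtain ⟨v0, hv0, r0⟩ : ∃ v ∈ σ.1, rank σ.1 v = p := by
    have : p ∈ σ.1.image (rank σ.1) := by
      rw [image_rank, σ.2.2]; exact Finset.mem_range.2 (by omega)
    simpa using this
  have hL : coboundary K n (cupCochain h a b) σ =
      ∑ v ∈ σ.1, ext0 a (front (σ.1.erase v) p) * ext0 b (back (σ.1.erase v) p) := by
    rw [← Finset.sum_attach]
    refine Finset.sum_congr rfl fun v _ => ?_
    exact (congrArg₂ (· * ·) (ext0_val a ((σ.facet v).frontFace h))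
      (ext0_val b ((σ.facet v).backFace h))).symm
  have hA : cupCochain h1 (coboundary K p a) b σ =
      ∑ v ∈ σ.1.filter (fun v => rank σ.1 v ≤ p + 1),
        ext0 a ((front σ.1 (p + 1)).erase v) * ext0 b (back σ.1 (p + 1)) := by
    rw [← Finset.sum_mul, cupCochain, coboundary_apply, ← ext0_val b]
    rfl
  have hB : cupCochain h2 a (coboundary K q b) σ =
      ∑ v ∈ σ.1.filter (fun v => p ≤ rank σ.1 v),
        ext0 a (front σ.1 p) * ext0 b ((back σ.1 p).erase v) := by
    rw [← Finset.mul_sum, cupCochain, coboundary_apply, ← ext0_val a]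
    rfl
  set x : ZMod 2 := ext0 a (front σ.1 p) * ext0 b (back σ.1 (p + 1)) with hx
  have hA' : cupCochain h1 (coboundary K p a) b σ =
      ∑ v ∈ σ.1.filter (fun v => rank σ.1 v ≤ p),
        ext0 a (front (σ.1.erase v) p) * ext0 b (back (σ.1.erase v) p) + x := by
    have hs : σ.1.filter (fun v => rank σ.1 v ≤ p + 1) =
        insert v1 (σ.1.filter (fun v => rank σ.1 v ≤ p)) := by
      ext w
      simp only [Finset.mem_filter, Finset.mem_insert]
      constructor
      · rintro ⟨hw, hr⟩
        rcases hr.lt_or_eq with hr | hr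
        · exact Or.inr ⟨hw, by omega⟩
        · exact Or.inl (rank_injOn σ.1 hw hv1 (hr.trans r1.symm))
      · rintro (rfl | ⟨hw, hr⟩)
        · exact ⟨hv1, r1.le⟩
        · exact ⟨hw, by omega⟩
    rw [hA, hs, Finset.sum_insert (by simp [r1]), add_comm]
    congr 1
    · refine Finset.sum_congr rfl fun v hv => ?_
      obtain ⟨hv, hr⟩ := Finset.mem_filter.1 hv
      rw [front_erase_of_le hv (by omega), back_erase_of_le hv hr]
    · rw [← front_erase_of_le hv1 r1.le, front_erase_of_lt hv1 (by omega)]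
  have hB' : cupCochain h2 a (coboundary K q b) σ =
      ∑ v ∈ σ.1.filter (fun v => ¬ rank σ.1 v ≤ p),
        ext0 a (front (σ.1.erase v) p) * ext0 b (back (σ.1.erase v) p) + x := by
    have hs : σ.1.filter (fun v => p ≤ rank σ.1 v) =
        insert v0 (σ.1.filter (fun v => ¬ rank σ.1 v ≤ p)) := by
      ext w
      simp only [Finset.mem_filter, Finset.mem_insert]
      constructor
      · rintro ⟨hw, hr⟩
        rcases hr.lt_or_eq with hr | hr
        · exact Or.inr ⟨hw, by omega⟩
        · exact Or.inl (rank_injOn σ.1 hw hv0 (hr.symm.trans r0.symm))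
      · rintro (rfl | ⟨hw, hr⟩)
        · exact ⟨hv0, r0.ge⟩
        · exact ⟨hw, by omega⟩
    rw [hB, hs, Finset.sum_insert (by simp [r0]), add_comm]
    congr 1
    · refine Finset.sum_congr rfl fun v hv => ?_
      obtain ⟨hv, hr⟩ := Finset.mem_filter.1 hv
      rw [front_erase_of_lt hv (by omega), back_erase_of_le_rank hv (by omega)]
    · rw [← back_erase_of_le_rank hv0 r0.ge, back_erase_of_le hv0 r0.le]
  rw [hL, Pi.add_apply, hA', hB', ← Finset.sum_filter_add_sum_filter_not σ.1
    (fun v => rank σ.1 v ≤ p)]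
  have hxx : x + x = 0 := CharTwo.add_self_eq_zero x
  linear_combination -hxx

/-- The cup product of cocycles. -/
def cupCocycle {p q n : ℕ} (h : p + q = n) (a : cocycles K p) (b : cocycles K q) :
    cocycles K n :=
  ⟨cupCochain h a.1 b.1, by
    have ha : coboundary K p a.1 = 0 := a.2
    have hb : coboundary K q b.1 = 0 := b.2
    change coboundary K n (cupCochain h a.1 b.1) = 0
    rw [coboundary_cupCochain, ha, hb]
    funext σ
    simp [cupCochain]⟩

theorem cupCochain_mem_left {p q n : ℕ} (h : p + q = n) {a : Cochain K p}
    (ha : a ∈ coboundaries K p) {b : Cochain K q} (hb : b ∈ cocycles K q) :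
    cupCochain h a b ∈ coboundaries K n := by
  replace hb : coboundary K q b = 0 := hb
  cases p with
  | zero =>
    have : a = 0 := by simpa [coboundaries] using ha
    have h0 : cupCochain h a b = 0 := by funext σ; simp [cupCochain, this]
    rw [h0]; exact Submodule.zero_mem _
  | succ p =>
    obtain ⟨c, rfl⟩ := ha
    obtain ⟨m, rfl⟩ : ∃ m, n = m + 1 := ⟨p + q, by omega⟩
    refine ⟨cupCochain (by omega : p + q = m) c b, ?_⟩
    rw [coboundary_cupCochain, hb]
    funext σ
    simp [cupCochain]

theorem cupCochain_mem_right {p q n : ℕ} (h : p + q = n) {a : Cochain K p}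
    (ha : a ∈ cocycles K p) {b : Cochain K q} (hb : b ∈ coboundaries K q) :
    cupCochain h a b ∈ coboundaries K n := by
  replace ha : coboundary K p a = 0 := ha
  cases q with
  | zero =>
    have : b = 0 := by simpa [coboundaries] using hb
    have h0 : cupCochain h a b = 0 := by funext σ; simp [cupCochain, this]
    rw [h0]; exact Submodule.zero_mem _
  | succ q =>
    obtain ⟨c, rfl⟩ := hb
    obtain ⟨m, rfl⟩ : ∃ m, n = m + 1 := ⟨p + q, by omega⟩
    refine ⟨cupCochain (by omega : p + q = m) a c, ?_⟩
    rw [coboundary_cupCochain, ha]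
    funext σ
    simp [cupCochain]

/-- The cup product `⌣ : H^p(K) × H^q(K) → H^n(K)`, `n = p + q`, with `[a] ⌣ [b] = [a ⌣ b]`. -/
def cup {p q n : ℕ} (h : p + q = n) :
    Cohomology K p → Cohomology K q → Cohomology K n :=
  Quotient.map₂ (cupCocycle h) (by
    intro a a' haa b b' hbb
    have h1 : a.1 - a'.1 ∈ coboundaries K p :=
      (Submodule.quotientRel_def ((coboundaries K p).submoduleOf (cocycles K p))).1 haa
    have h2 : b.1 - b'.1 ∈ coboundaries K q :=
      (Submodule.quotientRel_def ((coboundaries K q).submoduleOf (cocycles K q))).1 hbb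
    refine (Submodule.quotientRel_def _).2 ?_
    change cupCochain h a.1 b.1 - cupCochain h a'.1 b'.1 ∈ coboundaries K n
    have : cupCochain h a.1 b.1 - cupCochain h a'.1 b'.1 =
        cupCochain h (a.1 - a'.1) b.1 + cupCochain h a'.1 (b.1 - b'.1) := by
      rw [cupCochain_sub_left, cupCochain_sub_right]; abel
    rw [this]
    exact Submodule.add_mem _ (cupCochain_mem_left h h1 b.2) (cupCochain_mem_right h a'.2 h2))

theorem cup_cls {p q n : ℕ} (h : p + q = n) (a : cocycles K p) (b : cocycles K q) :
    cup h (cls a) (cls b) = cls (cupCocycle h a b) := rfl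

/-- The unit cocycle, with value `1` on every vertex. -/
def oneCocycle (K : PreAbstractSimplicialComplex V) : cocycles K 0 :=
  ⟨fun _ => 1, by
    change coboundary K 0 _ = 0
    funext σ
    change ∑ v ∈ σ.1.attach, (1 : ZMod 2) = 0
    rw [Finset.sum_const, Finset.card_attach, σ.2.2]
    rfl⟩

/-- `IsProduct K [s₁, …, s_ℓ] n x`: the class `x ∈ H^n(K)` is a cup product
`α₁ ⌣ … ⌣ α_ℓ` with `α_j ∈ H^{s_j}(K)` (the empty product being the unit of `H^0(K)`). -/
inductive IsProduct (K : PreAbstractSimplicialComplex V) :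
    List ℕ → (n : ℕ) → Cohomology K n → Prop
  | nil : IsProduct K [] 0 (cls (oneCocycle K))
  | cons {s m n : ℕ} {l : List ℕ} (h : s + m = n) (α : Cohomology K s) (β : Cohomology K m)
      (hβ : IsProduct K l m β) : IsProduct K (s :: l) n (cup h α β)

/-- For a partition `{s₁ ≤ … ≤ s_ℓ}` of `q`, the subspace of `H^q(K)` spanned by the products
`α₁ ⌣ … ⌣ α_ℓ` with `α_j ∈ H^{s_j}(K)`. -/
def partitionSubmodule {q : ℕ} (lam : Nat.Partition q) (K : PreAbstractSimplicialComplex V) :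
    Submodule (ZMod 2) (Cohomology K q) :=
  Submodule.span (ZMod 2) {x | IsProduct K (lam.parts.sort (· ≤ ·)) q x}

/-! ### Maps induced by inclusions -/

variable {L : PreAbstractSimplicialComplex V}

/-- A simplex of a subcomplex, as a simplex of the larger complex. -/
def Simplex.incl (h : K ≤ L) {p : ℕ} (σ : Simplex K p) : Simplex L p :=
  ⟨σ.1, h σ.2.1, σ.2.2⟩

/-- Restriction of cochains to a subcomplex. -/
def restrictCochain (h : K ≤ L) (p : ℕ) : Cochain L p →ₗ[ZMod 2] Cochain K p :=
  LinearMap.funLeft (ZMod 2) (ZMod 2) (Simplex.incl h)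

theorem coboundary_restrictCochain (h : K ≤ L) (p : ℕ) (c : Cochain L p) :
    coboundary K p (restrictCochain h p c) = restrictCochain h (p + 1) (coboundary L p c) :=
  rfl

theorem restrictCochain_mem_cocycles (h : K ≤ L) (p : ℕ) (c : Cochain L p)
    (hc : c ∈ cocycles L p) : restrictCochain h p c ∈ cocycles K p := by
  replace hc : coboundary L p c = 0 := hc
  change coboundary K p (restrictCochain h p c) = 0
  rw [coboundary_restrictCochain, hc, map_zero]

/-- Restriction of cocycles to a subcomplex. -/
def restrictCocycle (h : K ≤ L) (p : ℕ) : cocycles L p →ₗ[ZMod 2] cocycles K p :=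
  (restrictCochain h p).restrict (restrictCochain_mem_cocycles h p)

theorem restrictCochain_mem_coboundaries (h : K ≤ L) (p : ℕ) (c : Cochain L p)
    (hc : c ∈ coboundaries L p) : restrictCochain h p c ∈ coboundaries K p := by
  cases p with
  | zero =>
    have : c = 0 := by simpa [coboundaries] using hc
    rw [this, map_zero]; exact Submodule.zero_mem _
  | succ p =>
    obtain ⟨b, rfl⟩ := hc
    exact ⟨restrictCochain h p b, rfl⟩

/-- The map `H^p(L) → H^p(K)` induced by an inclusion `K ≤ L`. -/
def cohomologyMap (h : K ≤ L) (p : ℕ) : Cohomology L p →ₗ[ZMod 2] Cohomology K p :=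
  Submodule.mapQ _ _ (restrictCocycle h p) (by
    intro c hc
    exact restrictCochain_mem_coboundaries h p c.1 hc)

theorem cohomologyMap_cls (h : K ≤ L) (p : ℕ) (z : cocycles L p) :
    cohomologyMap h p (cls z) = cls (restrictCocycle h p z) := rfl

theorem cohomologyMap_cup (h : K ≤ L) {p q n : ℕ} (hn : p + q = n) (α : Cohomology L p)
    (β : Cohomology L q) :
    cohomologyMap h n (cup hn α β) = cup hn (cohomologyMap h p α) (cohomologyMap h q β) := by
  obtain ⟨a, rfl⟩ := Submodule.Quotient.mk_surjective _ α
  obtain ⟨b, rfl⟩ := Submodule.Quotient.mk_surjective _ β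
  rfl

theorem cohomologyMap_isProduct (h : K ≤ L) {l : List ℕ} {n : ℕ} {x : Cohomology L n}
    (hx : IsProduct L l n x) : IsProduct K l n (cohomologyMap h n x) := by
  induction hx with
  | nil => exact IsProduct.nil
  | cons hn α β _ ih =>
    rw [cohomologyMap_cup]
    exact IsProduct.cons hn _ _ ih

theorem cohomologyMap_mem_partitionSubmodule (h : K ≤ L) {q : ℕ} (lam : Nat.Partition q)
    (x : Cohomology L q) (hx : x ∈ partitionSubmodule lam L) :
    cohomologyMap h q x ∈ partitionSubmodule lam K := by
  induction hx using Submodule.span_induction with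
  | mem x hx => exact Submodule.subset_span (cohomologyMap_isProduct h hx)
  | zero => rw [map_zero]; exact Submodule.zero_mem _
  | add x y _ _ hx hy => rw [map_add]; exact Submodule.add_mem _ hx hy
  | smul r x _ hx => rw [map_smul]; exact Submodule.smul_mem _ r hx

/-- The restriction of `H^q(L) → H^q(K)` to the partition submodules. -/
def partitionMap (h : K ≤ L) {q : ℕ} (lam : Nat.Partition q) :
    partitionSubmodule lam L →ₗ[ZMod 2] partitionSubmodule lam K :=
  (cohomologyMap h q).restrict (cohomologyMap_mem_partitionSubmodule h lam)

end Cohomology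

/-! ### Persistence modules and the interleaving distance -/

/-- Persistence modules of `ZMod 2`-vector spaces over `ℝ`, with structure maps
`M_b → M_a` for `a ≤ b` (as is the case for cohomology). -/
abbrev PersistenceModule : Type 1 := ℝᵒᵖ ⥤ ModuleCat.{0} (ZMod 2)

/-- The space of `M` at `a`. -/
abbrev PersistenceModule.at (M : PersistenceModule) (a : ℝ) : ModuleCat.{0} (ZMod 2) :=
  M.obj (Opposite.op a)

/-- The structure map `M_b → M_a` for `a ≤ b`. -/
abbrev PersistenceModule.str (M : PersistenceModule) {a b : ℝ} (h : a ≤ b) : M.at b ⟶ M.at a :=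
  M.map (homOfLE h).op

/-- An `ε`-interleaving of `M` and `N`: morphisms `F_a : M_{a+ε} → N_a` and
`G_a : N_{a+ε} → M_a`, natural in `a`, whose composites `M_{a+2ε} → M_a` and
`N_{a+2ε} → N_a` are the structure maps. -/
structure Interleaving (M N : PersistenceModule) (ε : ℝ≥0) where
  F (a : ℝ) : M.at (a + ε) ⟶ N.at a
  G (a : ℝ) : N.at (a + ε) ⟶ M.at a
  F_natural (a b : ℝ) (h : a ≤ b) :
    M.str (add_le_add_left h (ε : ℝ)) ≫ F a = F b ≫ N.str h
  G_natural (a b : ℝ) (h : a ≤ b) :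
    N.str (add_le_add_left h (ε : ℝ)) ≫ G a = G b ≫ M.str h
  F_G (a : ℝ) : F (a + ε) ≫ G a =
    M.str ((le_add_of_nonneg_right ε.2).trans (le_add_of_nonneg_right ε.2))
  G_F (a : ℝ) : G (a + ε) ≫ F a =
    N.str ((le_add_of_nonneg_right ε.2).trans (le_add_of_nonneg_right ε.2))

/-- The interleaving distance: the infimum of all `ε ≥ 0` such that `M` and `N` are
`ε`-interleaved (`∞` if there are none). -/
def interleavingDist (M N : PersistenceModule) : ℝ≥0∞ :=
  ⨅ (ε : ℝ≥0) (_ : Nonempty (Interleaving M N ε)), (ε : ℝ≥0∞)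

/-- The `lam`-partition module of a filtration (indexed by `ℝ`) of simplicial complexes. -/
def partitionModule {V : Type} [LinearOrder V] {q : ℕ} (lam : Nat.Partition q)
    (K : ℝ →o PreAbstractSimplicialComplex V) : PersistenceModule where
  obj a := ModuleCat.of (ZMod 2) (partitionSubmodule lam (K a.unop))
  map f := ModuleCat.ofHom (partitionMap (K.monotone f.unop.le) lam)
  map_id a := by
    ext x
    obtain ⟨x, hx⟩ := x
    obtain ⟨z, rfl⟩ := Submodule.Quotient.mk_surjective _ x
    rfl
  map_comp f g := by
    ext x
    obtain ⟨x, hx⟩ := x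
    obtain ⟨z, rfl⟩ := Submodule.Quotient.mk_surjective _ x
    rfl

/-! ### Rips and Čech filtrations, Gromov–Hausdorff distance -/

/-- The Rips filtration of a metric space: at scale `t`, the nonempty finite subsets of diameter
at most `t` (none if `t < 0`). -/
def rips (X : Type) [MetricSpace X] : ℝ →o PreAbstractSimplicialComplex X where
  toFun t :=
    { faces := {S | S.Nonempty ∧ Metric.diam (S : Set X) ≤ t}
      isRelLowerSet_faces := by
        intro S hS
        refine ⟨hS.1, fun T hT hne => ⟨hne, ?_⟩⟩
        exact (Metric.diam_mono (Finset.coe_subset.2 hT) S.finite_toSet.isBounded).trans hS.2 }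
  monotone' := fun _ _ h _ hS => ⟨hS.1, hS.2.trans h⟩

/-- The Čech filtration of a finite point set `X` in `ℝ^d`: at radius `r`, the nonempty finite
subsets `S` of `X` such that the closed balls of radius `r` centred at the points of `S` have a
common point in `ℝ^d` (none if `r < 0`). -/
def cech {d : ℕ} (X : Finset (EuclideanSpace ℝ (Fin d))) :
    ℝ →o PreAbstractSimplicialComplex X where
  toFun r :=
    { faces := {S | S.Nonempty ∧
        (⋂ x ∈ S, Metric.closedBall (x : EuclideanSpace ℝ (Fin d)) r).Nonempty}
      isRelLowerSet_faces := by
        intro S hS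
        refine ⟨hS.1, fun T hT hne => ⟨hne, ?_⟩⟩
        exact hS.2.mono (Set.biInter_subset_biInter_left hT) }
  monotone' := fun _ _ h _ hS =>
    ⟨hS.1, hS.2.mono (Set.iInter₂_mono fun _ _ => Metric.closedBall_subset_closedBall h)⟩

/-- The Gromov–Hausdorff distance of two metric spaces: the infimum of the Hausdorff distances of
the images under isometric embeddings into a common metric space. With values in `[0, ∞]`, so
that empty spaces are allowed. -/
def ghEDist (X Y : Type) [MetricSpace X] [MetricSpace Y] : ℝ≥0∞ :=
  ⨅ (M : Type) (_ : MetricSpace M) (f : X → M) (g : Y → M) (_ : Isometry f) (_ : Isometry g),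
    Metric.hausdorffEDist (Set.range f) (Set.range g)

/-- On nonempty compact spaces this is Mathlib's Gromov–Hausdorff distance. -/
theorem ghEDist_eq_ghDist (X Y : Type) [MetricSpace X] [CompactSpace X] [Nonempty X]
    [MetricSpace Y] [CompactSpace Y] [Nonempty Y] :
    ghEDist X Y = ENNReal.ofReal (GromovHausdorff.ghDist X Y) := by
  have key : ∀ (M : Type) (_ : MetricSpace M) (f : X → M) (g : Y → M), Isometry f → Isometry g →
      Metric.hausdorffEDist (Set.range f) (Set.range g) =
        ENNReal.ofReal (Metric.hausdorffDist (Set.range f) (Set.range g)) := by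
    intro M _ f g hf hg
    refine (ENNReal.ofReal_toReal ?_).symm
    exact Metric.hausdorffEDist_ne_top_of_nonempty_of_bounded (Set.range_nonempty _)
      (Set.range_nonempty _) (isCompact_range hf.continuous).isBounded
      (isCompact_range hg.continuous).isBounded
  apply le_antisymm
  · rw [← GromovHausdorff.hausdorffDist_optimal,
      ← key _ _ _ _ (GromovHausdorff.isometry_optimalGHInjl X Y)
        (GromovHausdorff.isometry_optimalGHInjr X Y)]
    exact iInf₂_le_of_le _ inferInstance <| iInf₂_le_of_le _ _ <|
      iInf₂_le_of_le (GromovHausdorff.isometry_optimalGHInjl X Y)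
        (GromovHausdorff.isometry_optimalGHInjr X Y) le_rfl
  · refine le_iInf₂ fun M _ => le_iInf₂ fun f g => le_iInf₂ fun hf hg => ?_
    rw [key M _ f g hf hg]
    exact ENNReal.ofReal_le_ofReal (GromovHausdorff.ghDist_le_hausdorffDist hf hg)

end PartitionModules

end

/-!
Points of `X` and `Y` that are close in an ambient space are related by maps `f : X → Y` and
`g : Y → X` which move points by at most `δ`. These are simplicial maps between the Rips or Čech
complexes after a shift of the scale by `2 δ`, and the two composites are contiguous to the
inclusions (`isSimplicial_rips`, `contiguous_rips`, `isSimplicial_cech`, `contiguous_cech`). So a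
`2 δ`-interleaving of the partition modules exists as soon as simplicial maps induce maps in
cohomology that are functorial, agree for contiguous maps, and respect cup products
(`nonempty_interleaving`).

Mod 2 a simplicial map pulls back cochains by `c ↦ (σ ↦ c (f σ))`, with value `0` where `f` is not
injective on `σ`; no order of the vertices is needed. That this commutes with the coboundary, and
that the prism operator is a homotopy between contiguous maps, both rest on
`sum_ext0_image_erase`: the coboundary may be evaluated on lists of vertices with repetitions.

The cup product of cochains does depend on the order of the vertices, and `f` need not be monotone,
so multiplicativity holds in cohomology only (`pull_cup`). For an order-preserving injection it
holds already for cochains. A general `f : V → W` into a complex `L` factors as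
`V → V ⊕ W → W`, an order-preserving inclusion followed by the retraction `r = (f, id)`, where
`V ⊕ W` is ordered lexicographically and carries the complex of all sets mapped by `r` onto faces of
`L`. The order-preserving inclusion `j : W → V ⊕ W` satisfies `r ∘ j = id`, and `j ∘ r` is contiguous
to the identity. Hence `r^*` is the inverse of the multiplicative map `j^*`, and so it is
multiplicative as well (`pull_comapComplex_cup`).
-/

noncomputable section

namespace PartitionModules

/-! ### Pullback of cochains along simplicial maps -/

section Pullback

variable {U V W : Type}
  {J : PreAbstractSimplicialComplex U} {K : PreAbstractSimplicialComplex V}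
  {L : PreAbstractSimplicialComplex W}

theorem ext0_of_mem {p : ℕ} (c : Cochain K p) {τ : Finset V} (h : τ ∈ K ∧ τ.card = p + 1) :
    ext0 c τ = c (⟨τ, h⟩ : Simplex K p) := dif_pos h

theorem ext0_of_card_ne {p : ℕ} (c : Cochain K p) {τ : Finset V} (h : τ.card ≠ p + 1) :
    ext0 c τ = 0 := dif_neg fun h' => h h'.2

theorem ext0_zero {p : ℕ} (τ : Finset V) : ext0 (0 : Cochain K p) τ = 0 := by
  unfold ext0
  split_ifs <;> rfl

variable [LinearOrder W]

/-- A map of vertices is simplicial if it maps faces of `K` onto faces of `L`. -/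
def IsSimplicial (K : PreAbstractSimplicialComplex V) (L : PreAbstractSimplicialComplex W)
    (f : V → W) : Prop :=
  ∀ σ ∈ K, σ.image f ∈ L

/-- The pullback `(f^# c)(σ) = c(f(σ))`, which is `0` where `f` is not injective on `σ`. Mod 2
there are no signs, so no order of the vertices enters. -/
def pullCochain (K : PreAbstractSimplicialComplex V) (L : PreAbstractSimplicialComplex W)
    (f : V → W) (p : ℕ) : Cochain L p →ₗ[ZMod 2] Cochain K p where
  toFun c := fun σ => ext0 c (σ.1.image f)
  map_add' a b := by
    funext σ
    change ext0 (a + b) _ = ext0 a _ + ext0 b _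
    unfold ext0
    split_ifs
    · rfl
    · exact (add_zero 0).symm
  map_smul' r a := by
    funext σ
    change ext0 (r • a) _ = r • ext0 a _
    unfold ext0
    split_ifs
    · rfl
    · exact (smul_zero r).symm

theorem pullCochain_apply (f : V → W) {p : ℕ} (c : Cochain L p) (σ : Simplex K p) :
    pullCochain K L f p c σ = ext0 c (σ.1.image f) := rfl

theorem ext0_pullCochain (f : V → W) {p : ℕ} (c : Cochain L p) {τ : Finset V}
    (h : τ ∈ K ∧ τ.card = p + 1) : ext0 (pullCochain K L f p c) τ = ext0 c (τ.image f) :=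
  ext0_of_mem _ h

variable [LinearOrder V]

theorem IsSimplicial.comp {f : U → V} {g : V → W} (hg : IsSimplicial K L g)
    (hf : IsSimplicial J K f) : IsSimplicial J L (g ∘ f) := fun σ hσ => by
  rw [← Finset.image_image]
  exact hg _ (hf σ hσ)

theorem isSimplicial_id {K K' : PreAbstractSimplicialComplex V} (h : K ≤ K') :
    IsSimplicial K K' id := fun σ hσ => by
  rw [Finset.image_id]
  exact h hσ

/-- The coboundary of a cochain can be computed on any list of `p + 2` vertices, repetitions
being allowed: if exactly two entries agree, the two facets omitting one of them cancel mod 2, and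
with more coincidences every facet is degenerate. -/
theorem sum_ext0_image_erase {ι : Type} [DecidableEq ι] {p : ℕ} (c : Cochain L p) (s : Finset ι)
    (φ : ι → W) (hs : s.card = p + 2) (hL : s.image φ ∈ L) :
    ∑ i ∈ s, ext0 c ((s.erase i).image φ) = ext0 (coboundary L p c) (s.image φ) := by
  classical
  by_cases hinj : Set.InjOn φ s
  · have hcard : (s.image φ).card = p + 1 + 1 := by rw [Finset.card_image_of_injOn hinj, hs]
    rw [ext0_of_mem _ ⟨hL, hcard⟩]
    refine Eq.trans ?_ (coboundary_apply c (⟨s.image φ, hL, hcard⟩ : Simplex L (p + 1))).symm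
    change _ = ∑ w ∈ s.image φ, ext0 c ((s.image φ).erase w)
    rw [Finset.sum_image hinj]
    refine Finset.sum_congr rfl fun i hi => congrArg _ ?_
    ext w
    simp only [Finset.mem_image, Finset.mem_erase]
    constructor
    · rintro ⟨j, ⟨hj, hjs⟩, rfl⟩
      exact ⟨fun h => hj (hinj hjs hi h), j, hjs, rfl⟩
    · rintro ⟨hw, j, hjs, rfl⟩
      exact ⟨j, ⟨fun h => hw (h ▸ rfl), hjs⟩, rfl⟩
  · have hcard : (s.image φ).card ≠ p + 1 + 1 := by
      rw [← hs]; exact fun h => hinj (Finset.card_image_iff.1 h)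
    rw [ext0_of_card_ne _ hcard]
    simp only [Set.InjOn, not_forall] at hinj
    obtain ⟨i, hi, j, hj, hφ, hij⟩ := hinj
    have himg : ∀ a ∈ s, ∀ b ∈ s, a ≠ b → φ a = φ b →
        (s.erase a).image φ = s.image φ := by
      intro a _ b hb hab hφ
      refine (Finset.image_subset_image (Finset.erase_subset _ _)).antisymm fun w hw => ?_
      obtain ⟨k, hk, rfl⟩ := Finset.mem_image.1 hw
      by_cases hka : k = a
      · exact Finset.mem_image.2 ⟨b, Finset.mem_erase.2 ⟨hab.symm, hb⟩, by rw [hka, hφ]⟩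
      · exact Finset.mem_image_of_mem _ (Finset.mem_erase.2 ⟨hka, hk⟩)
    rw [← Finset.add_sum_erase _ _ hi,
      ← Finset.add_sum_erase _ _ (Finset.mem_erase.2 ⟨Ne.symm hij, hj⟩), himg i hi j hj hij hφ,
      himg j hj i hi (Ne.symm hij) hφ.symm, ← add_assoc, CharTwo.add_self_eq_zero, zero_add]
    refine Finset.sum_eq_zero fun k hk => ext0_of_card_ne _ ?_
    simp only [Finset.mem_erase] at hk
    obtain ⟨hkj, hki, hks⟩ := hk
    -- Omitting `i` as well does not change the image, which has at most `p` elements.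
    have hsub : (s.erase k).image φ ⊆ ((s.erase k).erase i).image φ := by
      intro w hw
      obtain ⟨l, hl, rfl⟩ := Finset.mem_image.1 hw
      by_cases hli : l = i
      · exact Finset.mem_image.2
          ⟨j, by simp [Ne.symm hij, Ne.symm hkj, Finset.mem_coe.1 hj], by rw [hli, hφ]⟩
      · exact Finset.mem_image_of_mem _ (Finset.mem_erase.2 ⟨hli, hl⟩)
    have h1 := (Finset.card_le_card hsub).trans Finset.card_image_le
    rw [Finset.card_erase_of_mem (Finset.mem_erase.2 ⟨Ne.symm hki, hi⟩),
      Finset.card_erase_of_mem hks] at h1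
    omega

theorem coboundary_pullCochain {f : V → W} (hf : IsSimplicial K L f) {p : ℕ} (c : Cochain L p) :
    coboundary K p (pullCochain K L f p c) = pullCochain K L f (p + 1) (coboundary L p c) := by
  funext σ
  rw [coboundary_apply, pullCochain_apply,
    ← sum_ext0_image_erase c σ.1 f σ.2.2 (hf _ σ.2.1)]
  exact Finset.sum_congr rfl fun v hv => ext0_pullCochain f c (σ.facet ⟨v, hv⟩).2

theorem pullCochain_mem_cocycles {f : V → W} (hf : IsSimplicial K L f) (p : ℕ) (c : Cochain L p)
    (hc : c ∈ cocycles L p) : pullCochain K L f p c ∈ cocycles K p := by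
  replace hc : coboundary L p c = 0 := hc
  change coboundary K p _ = 0
  rw [coboundary_pullCochain hf, hc, map_zero]

theorem pullCochain_mem_coboundaries {f : V → W} (hf : IsSimplicial K L f) (p : ℕ)
    (c : Cochain L p) (hc : c ∈ coboundaries L p) : pullCochain K L f p c ∈ coboundaries K p := by
  cases p with
  | zero =>
    have : c = 0 := by simpa [coboundaries] using hc
    rw [this, map_zero]; exact Submodule.zero_mem _
  | succ p =>
    obtain ⟨b, rfl⟩ := hc
    exact ⟨pullCochain K L f p b, coboundary_pullCochain hf b⟩

/-- The pullback of cocycles along a simplicial map. -/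
def pullCocycle {f : V → W} (hf : IsSimplicial K L f) (p : ℕ) :
    cocycles L p →ₗ[ZMod 2] cocycles K p :=
  (pullCochain K L f p).restrict (pullCochain_mem_cocycles hf p)

/-- The map `f^* : H^p(L) → H^p(K)` induced by a simplicial map. -/
def pull {f : V → W} (hf : IsSimplicial K L f) (p : ℕ) :
    Cohomology L p →ₗ[ZMod 2] Cohomology K p :=
  Submodule.mapQ _ _ (pullCocycle hf p) fun c hc => pullCochain_mem_coboundaries hf p c.1 hc

theorem exists_cls_eq {p : ℕ} (x : Cohomology K p) : ∃ z, cls z = x :=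
  Submodule.Quotient.mk_surjective _ x

theorem cls_eq_cls {p : ℕ} {a b : cocycles K p} (h : a.1 - b.1 ∈ coboundaries K p) :
    cls a = cls b :=
  (Submodule.Quotient.eq _).2 h

variable [LinearOrder U] in
theorem pull_comp {f : U → V} {g : V → W} (hg : IsSimplicial K L g) (hf : IsSimplicial J K f)
    (p : ℕ) (x : Cohomology L p) : pull (hg.comp hf) p x = pull hf p (pull hg p x) := by
  obtain ⟨z, rfl⟩ := exists_cls_eq x
  refine congrArg cls (Subtype.ext (funext fun σ => ?_))
  change ext0 z.1 (σ.1.image (g ∘ f)) = ext0 (pullCochain K L g p z.1) (σ.1.image f)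
  by_cases h : (σ.1.image f).card = p + 1
  · rw [ext0_pullCochain g z.1 ⟨hf _ σ.2.1, h⟩, Finset.image_image]
  · rw [ext0_of_card_ne _ h, ← Finset.image_image, ext0_of_card_ne]
    have h1 := Finset.card_image_le (s := σ.1) (f := f)
    have h2 := Finset.card_image_le (s := σ.1.image f) (f := g)
    have h3 := σ.2.2
    omega

theorem pull_id {K K' : PreAbstractSimplicialComplex V} (h : K ≤ K') (p : ℕ)
    (x : Cohomology K' p) : pull (isSimplicial_id h) p x = cohomologyMap h p x := by
  obtain ⟨z, rfl⟩ := exists_cls_eq x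
  refine congrArg cls (Subtype.ext (funext fun σ => ?_))
  change ext0 z.1 (σ.1.image id) = z.1 (Simplex.incl h σ)
  rw [Finset.image_id]
  exact ext0_val z.1 (Simplex.incl h σ)

theorem cohomologyMap_rfl (p : ℕ) (x : Cohomology K p) : cohomologyMap le_rfl p x = x := by
  obtain ⟨z, rfl⟩ := exists_cls_eq x
  rfl

/-! ### Contiguous simplicial maps -/

/-- The vertices of the maximal simplex of the prism `σ × {0, 1}` that changes level at `v`: those
up to `v` on the lower level, those from `v` on the upper one. -/
def prism (σ : Finset V) (v : V) : Finset (V ⊕ V) :=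
  (σ.filter (· ≤ v)).disjSum (σ.filter (v ≤ ·))

/-- The section of the prism `σ × {0, 1}` whose first `k` vertices are on the lower level. -/
def prismCut (σ : Finset V) (k : ℕ) : Finset (V ⊕ V) :=
  (σ.filter (fun w => rank σ w < k)).disjSum (σ.filter (fun w => k ≤ rank σ w))

theorem card_prism {σ : Finset V} {v : V} (hv : v ∈ σ) : (prism σ v).card = σ.card + 1 := by
  have h : σ.filter (· ≤ v) = insert v (σ.filter (· < v)) := by
    ext w
    simp only [Finset.mem_filter, Finset.mem_insert, le_iff_lt_or_eq]
    constructor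
    · rintro ⟨h1, h2 | h2⟩
      exacts [Or.inr ⟨h1, h2⟩, Or.inl h2]
    · rintro (rfl | ⟨h1, h2⟩)
      exacts [⟨hv, Or.inr rfl⟩, ⟨h1, Or.inl h2⟩]
  have h2 := Finset.card_filter_add_card_filter_not (s := σ) (fun w => w < v)
  simp only [not_lt] at h2
  rw [prism, Finset.card_disjSum, h, Finset.card_insert_of_notMem (by simp)]
  omega

theorem rank_lt_rank_iff {σ : Finset V} {v w : V} (hv : v ∈ σ) (hw : w ∈ σ) :
    rank σ v < rank σ w ↔ v < w := by
  refine ⟨fun h => ?_, rank_lt_rank hv⟩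
  by_contra hlt
  rcases (not_lt.1 hlt).lt_or_eq with h' | h'
  · exact absurd (rank_lt_rank hw h') (by omega)
  · rw [h'] at h; exact lt_irrefl _ h

theorem prism_erase_inl {σ : Finset V} {v : V} (hv : v ∈ σ) :
    (prism σ v).erase (Sum.inl v) = prismCut σ (rank σ v) := by
  ext (w | w) <;>
    simp only [prism, prismCut, Finset.mem_erase, Finset.inl_mem_disjSum, Finset.inr_mem_disjSum,
      Finset.mem_filter, ne_eq, Sum.inl.injEq, reduceCtorEq, not_false_eq_true, true_and]
  · constructor
    · rintro ⟨h1, h2, h3⟩; exact ⟨h2, rank_lt_rank h2 (lt_of_le_of_ne h3 h1)⟩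
    · rintro ⟨h1, h2⟩
      have := (rank_lt_rank_iff h1 hv).1 h2
      exact ⟨this.ne, h1, this.le⟩
  · refine and_congr_right fun hw => ?_
    rw [← not_lt, ← not_lt, rank_lt_rank_iff hw hv]

theorem prism_erase_inr {σ : Finset V} {v : V} (hv : v ∈ σ) :
    (prism σ v).erase (Sum.inr v) = prismCut σ (rank σ v + 1) := by
  ext (w | w) <;>
    simp only [prism, prismCut, Finset.mem_erase, Finset.inl_mem_disjSum, Finset.inr_mem_disjSum,
      Finset.mem_filter, ne_eq, Sum.inr.injEq, reduceCtorEq, not_false_eq_true, true_and]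
  · refine and_congr_right fun hw => ?_
    rw [Nat.lt_succ_iff, ← not_lt, ← not_lt, rank_lt_rank_iff hv hw]
  · constructor
    · rintro ⟨h1, h2, h3⟩; exact ⟨h2, rank_lt_rank hv (lt_of_le_of_ne h3 (Ne.symm h1))⟩
    · rintro ⟨h1, h2⟩
      have := (rank_lt_rank_iff hv h1).1 h2
      exact ⟨this.ne', h1, this.le⟩

/-- Boundary of the prism mod 2: in the sum of a function over all facets of the maximal simplices
of `σ × {0, 1}`, the inner walls cancel and the bottom, the top and the sides remain. -/
theorem sum_prism_erase (σ : Finset V) (Φ : Finset (V ⊕ V) → ZMod 2) :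
    ∑ v ∈ σ, ∑ i ∈ prism σ v, Φ ((prism σ v).erase i) =
      Φ (σ.disjSum ∅) + Φ ((∅ : Finset V).disjSum σ) +
        ∑ w ∈ σ, ∑ v ∈ σ.erase w, Φ (prism (σ.erase w) v) := by
  have hsplit : ∀ v ∈ σ, ∑ i ∈ prism σ v, Φ ((prism σ v).erase i) =
      (Φ (prismCut σ (rank σ v)) + Φ (prismCut σ (rank σ v + 1))) +
        ∑ w ∈ σ.erase v, Φ (prism (σ.erase w) v) := by
    intro v hv
    have hL : v ∈ σ.filter (· ≤ v) := by simp [hv]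
    have hR : v ∈ σ.filter (v ≤ ·) := by simp [hv]
    have hE : ∑ w ∈ σ.erase v, Φ (prism (σ.erase w) v) =
        ∑ w ∈ (σ.filter (· ≤ v)).erase v, Φ ((prism σ v).erase (Sum.inl w)) +
          ∑ w ∈ (σ.filter (v ≤ ·)).erase v, Φ ((prism σ v).erase (Sum.inr w)) := by
      rw [← Finset.sum_filter_add_sum_filter_not (σ.erase v) (· ≤ v)]
      congr 1
      · refine Finset.sum_congr (Finset.filter_erase _ _ _) fun w hw => congrArg Φ ?_
        simp only [Finset.mem_erase, Finset.mem_filter] at hw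
        ext (x | x) <;>
          simp only [prism, Finset.mem_erase, Finset.inl_mem_disjSum, Finset.inr_mem_disjSum,
            Finset.mem_filter, ne_eq, Sum.inl.injEq, reduceCtorEq, not_false_eq_true, true_and]
        · exact and_assoc
        · have : v ≤ x → x ≠ w := by
            rintro h rfl; exact hw.1 (hw.2.2.antisymm h)
          tauto
      · refine Finset.sum_congr ?_ fun w hw => congrArg Φ ?_
        · ext w
          simp only [Finset.mem_filter, Finset.mem_erase]
          constructor
          · rintro ⟨⟨h1, h2⟩, h3⟩; exact ⟨h1, h2, (not_le.1 h3).le⟩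
          · rintro ⟨h1, h2, h3⟩; exact ⟨⟨h1, h2⟩, fun h => h1 (h.antisymm h3)⟩
        · simp only [Finset.mem_erase, Finset.mem_filter] at hw
          ext (x | x) <;>
            simp only [prism, Finset.mem_erase, Finset.inl_mem_disjSum, Finset.inr_mem_disjSum,
              Finset.mem_filter, ne_eq, Sum.inr.injEq, reduceCtorEq, not_false_eq_true, true_and]
          · have : x ≤ v → x ≠ w := by
              rintro h rfl; exact hw.1 (h.antisymm hw.2.2)
            tauto
          · exact and_assoc
    rw [hE, ← prism_erase_inl hv, ← prism_erase_inr hv]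
    have hD : ∀ f : V ⊕ V → ZMod 2, ∑ i ∈ prism σ v, f i =
        ∑ w ∈ σ.filter (· ≤ v), f (Sum.inl w) + ∑ w ∈ σ.filter (v ≤ ·), f (Sum.inr w) :=
      fun f => Finset.sum_disjSum _ _ f
    rw [hD, ← Finset.add_sum_erase _ _ hL, ← Finset.add_sum_erase _ _ hR]
    abel
  rw [Finset.sum_congr rfl hsplit, Finset.sum_add_distrib]
  congr 1
  · have htel : ∀ n, ∑ k ∈ Finset.range n, (Φ (prismCut σ k) + Φ (prismCut σ (k + 1))) =
        Φ (prismCut σ n) + Φ (prismCut σ 0) := by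
      intro n
      induction n with
      | zero => simp [CharTwo.add_self_eq_zero]
      | succ n ih =>
        rw [Finset.sum_range_succ, ih]
        linear_combination CharTwo.add_self_eq_zero (Φ (prismCut σ n))
    rw [← Finset.sum_image (f := fun k => Φ (prismCut σ k) + Φ (prismCut σ (k + 1)))
      (rank_injOn σ), image_rank, htel]
    congr 2
    · have h1 : σ.filter (fun w => rank σ w < σ.card) = σ :=
        Finset.filter_true_of_mem fun w hw => rank_lt_card hw
      have h2 : σ.filter (fun w => σ.card ≤ rank σ w) = ∅ :=
        Finset.filter_false_of_mem fun w hw => (rank_lt_card hw).not_ge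
      rw [prismCut, h1, h2]
    · simp [prismCut]
  · refine Finset.sum_comm' fun v w => ?_
    simp only [Finset.mem_erase]
    constructor
    · rintro ⟨a, b, c⟩; exact ⟨⟨Ne.symm b, a⟩, c⟩
    · rintro ⟨⟨a, b⟩, c⟩; exact ⟨b, Ne.symm a, c⟩

/-- Two maps are contiguous if the images of each face of `K` lie in a common face of `L`. -/
def Contiguous (K : PreAbstractSimplicialComplex V) (L : PreAbstractSimplicialComplex W)
    (f g : V → W) : Prop :=
  ∀ σ ∈ K, σ.image f ∪ σ.image g ∈ L

/-- The prism operator `C^{p+1}(L) → C^p(K)` of two contiguous maps. -/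
def prismCochain (K : PreAbstractSimplicialComplex V) (f g : V → W) {p : ℕ}
    (c : Cochain L (p + 1)) : Cochain K p :=
  fun σ => ∑ v ∈ σ.1, ext0 c ((prism σ.1 v).image (Sum.elim f g))

theorem image_prism_mem {f g : V → W} (h : Contiguous K L f g) {σ : Finset V} (hσ : σ ∈ K) {v : V}
    (hv : v ∈ σ) : (prism σ v).image (Sum.elim f g) ∈ L := by
  refine face_mem (h σ hσ) (fun w hw => ?_)
    (Finset.Nonempty.image ⟨Sum.inl v, by simp [prism, hv]⟩ _)
  obtain ⟨x | x, hx, rfl⟩ := Finset.mem_image.1 hw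
  · simp only [prism, Finset.inl_mem_disjSum, Finset.mem_filter] at hx
    exact Finset.mem_union_left _ (Finset.mem_image_of_mem f hx.1)
  · simp only [prism, Finset.inr_mem_disjSum, Finset.mem_filter] at hx
    exact Finset.mem_union_right _ (Finset.mem_image_of_mem g hx.1)

/-- The prism operator is a homotopy between `f^#` and `g^#`. -/
theorem prismCochain_coboundary {f g : V → W} (h : Contiguous K L f g) {p : ℕ} (c : Cochain L p)
    (σ : Simplex K p) :
    prismCochain K f g (coboundary L p c) σ =
      pullCochain K L f p c σ + pullCochain K L g p c σ +
        ∑ w ∈ σ.1, ∑ v ∈ σ.1.erase w,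
          ext0 c ((prism (σ.1.erase w) v).image (Sum.elim f g)) := by
  have h1 : prismCochain K f g (coboundary L p c) σ =
      ∑ v ∈ σ.1, ∑ i ∈ prism σ.1 v, ext0 c (((prism σ.1 v).erase i).image (Sum.elim f g)) := by
    refine Finset.sum_congr rfl fun v hv => (sum_ext0_image_erase c _ _ ?_ ?_).symm
    · rw [card_prism hv, σ.2.2]
    · exact image_prism_mem h σ.2.1 hv
  rw [h1, sum_prism_erase σ.1 (fun τ => ext0 c (τ.image (Sum.elim f g))), pullCochain_apply,
    pullCochain_apply]
  have e1 : (σ.1.disjSum (∅ : Finset V)).image (Sum.elim f g) = σ.1.image f := by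
    ext w; simp
  have e2 : ((∅ : Finset V).disjSum σ.1).image (Sum.elim f g) = σ.1.image g := by
    ext w; simp
  simp only [e1, e2]

theorem pull_eq_of_contiguous {f g : V → W} (hf : IsSimplicial K L f) (hg : IsSimplicial K L g)
    (h : Contiguous K L f g) (p : ℕ) (x : Cohomology L p) : pull hf p x = pull hg p x := by
  obtain ⟨z, rfl⟩ := exists_cls_eq x
  refine cls_eq_cls ?_
  change pullCochain K L f p z.1 - pullCochain K L g p z.1 ∈ coboundaries K p
  have hz : coboundary L p z.1 = 0 := z.2
  have h0 : ∀ σ : Simplex K p, prismCochain K f g (coboundary L p z.1) σ = 0 := by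
    intro σ
    rw [hz]
    exact Finset.sum_eq_zero fun v _ => ext0_zero _
  have key : ∀ σ : Simplex K p, (pullCochain K L f p z.1 - pullCochain K L g p z.1) σ =
      ∑ w ∈ σ.1, ∑ v ∈ σ.1.erase w,
        ext0 z.1 ((prism (σ.1.erase w) v).image (Sum.elim f g)) := by
    intro σ
    have h1 := (prismCochain_coboundary h z.1 σ).symm.trans (h0 σ)
    rw [Pi.sub_apply, CharTwo.sub_eq_add]
    exact CharTwo.add_eq_zero.1 h1
  cases p with
  | zero =>
    have : pullCochain K L f 0 z.1 - pullCochain K L g 0 z.1 = 0 := by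
      funext σ
      rw [key]
      refine Finset.sum_eq_zero fun w hw => ?_
      have hc : σ.1.erase w = ∅ := by
        rw [← Finset.card_eq_zero, Finset.card_erase_of_mem hw, σ.2.2]
      rw [hc, Finset.sum_empty]
    rw [this]
    exact Submodule.zero_mem _
  | succ p =>
    refine ⟨prismCochain K f g z.1, funext fun σ => ?_⟩
    rw [key, coboundary_apply]
    exact Finset.sum_congr rfl fun w hw => ext0_of_mem _ (σ.facet ⟨w, hw⟩).2

end Pullback

/-! ### Multiplicativity of the induced maps -/

section Multiplicative

variable {U V W : Type} [LinearOrder W]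
  {J : PreAbstractSimplicialComplex U} {K : PreAbstractSimplicialComplex V}
  {L M : PreAbstractSimplicialComplex W}

/-- The complex of all nonempty finite sets of vertices that `r` maps onto a face of `L`. -/
def comapComplex (L : PreAbstractSimplicialComplex W) (r : U → W) :
    PreAbstractSimplicialComplex U where
  faces := {S | S.Nonempty ∧ S.image r ∈ L}
  isRelLowerSet_faces := by
    intro S hS
    exact ⟨hS.1, fun T hT hne =>
      ⟨hne, face_mem hS.2 (Finset.image_subset_image hT) (hne.image r)⟩⟩

theorem isSimplicial_comapComplex (r : U → W) : IsSimplicial (comapComplex L r) L r :=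
  fun _ hS => hS.2

variable [LinearOrder U] [LinearOrder V]

theorem rank_image {f : V → W} (hf : StrictMono f) (σ : Finset V) (v : V) :
    rank (σ.image f) (f v) = rank σ v := by
  unfold rank
  rw [Finset.filter_image, Finset.card_image_of_injective _ hf.injective]
  simp only [hf.lt_iff_lt]

theorem front_image {f : V → W} (hf : StrictMono f) (σ : Finset V) (p : ℕ) :
    front (σ.image f) p = (front σ p).image f := by
  unfold front
  rw [Finset.filter_image]
  simp only [rank_image hf]

theorem back_image {f : V → W} (hf : StrictMono f) (σ : Finset V) (p : ℕ) :
    back (σ.image f) p = (back σ p).image f := by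
  unfold back
  rw [Finset.filter_image]
  simp only [rank_image hf]

/-- For an order-preserving injection the pullback of cochains respects the cup product on the
nose, since it respects front and back faces. -/
theorem pull_cup_of_strictMono {f : V → W} (hf : IsSimplicial K L f) (hmono : StrictMono f)
    {p q n : ℕ} (hn : p + q = n) (α : Cohomology L p) (β : Cohomology L q) :
    pull hf n (cup hn α β) = cup hn (pull hf p α) (pull hf q β) := by
  obtain ⟨a, rfl⟩ := exists_cls_eq α
  obtain ⟨b, rfl⟩ := exists_cls_eq β
  refine congrArg cls (Subtype.ext (funext fun σ => ?_))
  change ext0 (cupCochain hn a.1 b.1) (σ.1.image f) =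
    ext0 a.1 ((front σ.1 p).image f) * ext0 b.1 ((back σ.1 p).image f)
  have hcard : (σ.1.image f).card = n + 1 := by
    rw [Finset.card_image_of_injective _ hmono.injective, σ.2.2]
  let τ : Simplex L n := ⟨σ.1.image f, hf _ σ.2.1, hcard⟩
  rw [← front_image hmono, ← back_image hmono]
  exact (ext0_val (cupCochain hn a.1 b.1) τ).trans (congrArg₂ (· * ·)
    (ext0_val a.1 (τ.frontFace hn)) (ext0_val b.1 (τ.backFace hn))).symm

theorem pull_eq_cohomologyMap {K' : PreAbstractSimplicialComplex V} (hK : K ≤ K') {f : V → V}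
    (hf : IsSimplicial K K' f) (h : Contiguous K K' f id) (p : ℕ) (x : Cohomology K' p) :
    pull hf p x = cohomologyMap hK p x := by
  rw [pull_eq_of_contiguous hf (isSimplicial_id hK) h, pull_id]

/-- If `r` has an order-preserving section `j`, then `r^*` is the inverse of `j^*`, which respects
cup products. -/
theorem pull_comapComplex_cup {r : U → W} {j : W → U} (hmono : StrictMono j)
    (hrj : ∀ w, r (j w) = w) {p q n : ℕ} (hn : p + q = n) (α : Cohomology L p)
    (β : Cohomology L q) :
    pull (isSimplicial_comapComplex r) n (cup hn α β) =
      cup hn (pull (isSimplicial_comapComplex r) p α)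
        (pull (isSimplicial_comapComplex r) q β) := by
  have hcomp : r ∘ j = id := funext hrj
  have hr : IsSimplicial (comapComplex L r) L r := isSimplicial_comapComplex r
  have hj : IsSimplicial L (comapComplex L r) j := fun σ hσ =>
    ⟨((L.isRelLowerSet_faces hσ).1).image j, by
      rwa [Finset.image_image, hcomp, Finset.image_id]⟩
  have hjr : ∀ (k : ℕ) (x : Cohomology L k), pull hj k (pull hr k x) = x := by
    intro k x
    rw [← pull_comp hr hj, pull_eq_cohomologyMap le_rfl, cohomologyMap_rfl]
    intro σ hσ
    rwa [hcomp, Finset.union_self, Finset.image_id]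
  have hrj' : ∀ (k : ℕ) (x : Cohomology (comapComplex L r) k), pull hr k (pull hj k x) = x := by
    intro k x
    rw [← pull_comp hj hr, pull_eq_cohomologyMap le_rfl, cohomologyMap_rfl]
    intro σ hσ
    refine ⟨(hσ.1.image _).mono Finset.subset_union_left, ?_⟩
    rw [Finset.image_union, Finset.image_image, ← Function.comp_assoc, hcomp,
      Function.id_comp, Finset.image_id, Finset.union_self]
    exact hσ.2
  apply Function.LeftInverse.injective (hrj' n)
  rw [hjr, pull_cup_of_strictMono hj hmono, hjr, hjr]

/-- A simplicial map `f : V → W` factors as the order-preserving inclusion of `V` into `V ⊕ W`,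
ordered lexicographically, and the retraction `(f, id)` onto `W`. -/
theorem pull_cup {f : V → W} (hf : IsSimplicial K L f) {p q n : ℕ} (hn : p + q = n)
    (α : Cohomology L p) (β : Cohomology L q) :
    pull hf n (cup hn α β) = cup hn (pull hf p α) (pull hf q β) := by
  let r : V ⊕ₗ W → W := fun u => Sum.elim f id (ofLex u)
  let i : V → V ⊕ₗ W := fun v => toLex (Sum.inl v)
  let j : W → V ⊕ₗ W := fun w => toLex (Sum.inr w)
  have hi : StrictMono i := Sum.Lex.inl_strictMono
  have hj : StrictMono j := Sum.Lex.inr_strictMono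
  have hri : r ∘ i = f := rfl
  have hr : IsSimplicial (comapComplex L r) L r := isSimplicial_comapComplex r
  have his : IsSimplicial K (comapComplex L r) i := fun σ hσ =>
    ⟨((K.isRelLowerSet_faces hσ).1).image i, by
      rw [Finset.image_image, hri]; exact hf σ hσ⟩
  have hfac : ∀ (k : ℕ) (x : Cohomology L k), pull hf k x = pull his k (pull hr k x) :=
    fun k x => pull_comp hr his k x
  rw [hfac, hfac, hfac, pull_comapComplex_cup hj (fun _ => rfl), pull_cup_of_strictMono his hi]

theorem pull_one {f : V → W} (hf : IsSimplicial K L f) :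
    pull hf 0 (cls (oneCocycle L)) = cls (oneCocycle K) := by
  refine congrArg cls (Subtype.ext (funext fun σ => ?_))
  obtain ⟨v, hv⟩ := Finset.card_eq_one.1 σ.2.2
  have hcard : (σ.1.image f).card = 0 + 1 := by
    change σ.1 = {v} at hv
    rw [hv, Finset.image_singleton, Finset.card_singleton]
  exact ext0_of_mem (oneCocycle L).1 ⟨hf _ σ.2.1, hcard⟩

theorem pull_isProduct {f : V → W} (hf : IsSimplicial K L f) {l : List ℕ} {n : ℕ}
    {x : Cohomology L n} (hx : IsProduct L l n x) : IsProduct K l n (pull hf n x) := by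
  induction hx with
  | nil => rw [pull_one]; exact IsProduct.nil
  | cons hn α β _ ih =>
    rw [pull_cup]
    exact IsProduct.cons hn _ _ ih

theorem pull_mem_partitionSubmodule {f : V → W} (hf : IsSimplicial K L f) {q : ℕ}
    (lam : Nat.Partition q) (x : Cohomology L q) (hx : x ∈ partitionSubmodule lam L) :
    pull hf q x ∈ partitionSubmodule lam K := by
  have h : partitionSubmodule lam L ≤ (partitionSubmodule lam K).comap (pull hf q) :=
    Submodule.span_le.2 fun y hy => Submodule.subset_span (pull_isProduct hf hy)
  exact h hx

/-- The restriction of `f^*` to the partition submodules. -/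
def partitionPull {f : V → W} (hf : IsSimplicial K L f) {q : ℕ} (lam : Nat.Partition q) :
    partitionSubmodule lam L →ₗ[ZMod 2] partitionSubmodule lam K :=
  (pull hf q).restrict (pull_mem_partitionSubmodule hf lam)

theorem cohomologyMap_pull {K' : PreAbstractSimplicialComplex V} (h : K' ≤ K) {f : V → W}
    (hf : IsSimplicial K L f) (hf' : IsSimplicial K' L f) (p : ℕ) (x : Cohomology L p) :
    cohomologyMap h p (pull hf p x) = pull hf' p x := by
  rw [← pull_id, ← pull_comp]

theorem pull_cohomologyMap (h : L ≤ M) {f : V → W} (hf : IsSimplicial K L f)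
    (hf' : IsSimplicial K M f) (p : ℕ) (x : Cohomology M p) :
    pull hf p (cohomologyMap h p x) = pull hf' p x := by
  rw [← pull_id, ← pull_comp]

end Multiplicative

/-! ### Interleavings from simplicial maps -/

section Interleavings

/-- Maps of vertices that are simplicial up to a shift by `ε`, and inverse to each other up to
contiguity after a shift by `2 ε`, induce an `ε`-interleaving of the partition modules. -/
theorem nonempty_interleaving {V W : Type} [LinearOrder V] [LinearOrder W] {q : ℕ}
    (lam : Nat.Partition q) (K : ℝ →o PreAbstractSimplicialComplex V)
    (L : ℝ →o PreAbstractSimplicialComplex W) (ε : ℝ≥0) (f : V → W) (g : W → V)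
    (hf : ∀ a, IsSimplicial (K a) (L (a + ε)) f) (hg : ∀ a, IsSimplicial (L a) (K (a + ε)) g)
    (hgf : ∀ a, Contiguous (K a) (K (a + ε + ε)) (g ∘ f) id)
    (hfg : ∀ a, Contiguous (L a) (L (a + ε + ε)) (f ∘ g) id) :
    Nonempty (Interleaving (partitionModule lam K) (partitionModule lam L) ε) := by
  refine ⟨⟨fun a => ModuleCat.ofHom (partitionPull (hg a) lam),
    fun a => ModuleCat.ofHom (partitionPull (hf a) lam), fun a b h => ?_, fun a b h => ?_,
    fun a => ?_, fun a => ?_⟩⟩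
  · have hKL : IsSimplicial (L a) (K (b + ε)) g := fun σ hσ =>
      K.monotone (add_le_add_left h _) (hg a σ hσ)
    refine ModuleCat.hom_ext (LinearMap.ext fun x => Subtype.ext ?_)
    exact (pull_cohomologyMap (K.monotone (add_le_add_left h _)) (hg a) hKL q x.1).trans
      (cohomologyMap_pull (L.monotone h) (hg b) hKL q x.1).symm
  · have hKL : IsSimplicial (K a) (L (b + ε)) f := fun σ hσ =>
      L.monotone (add_le_add_left h _) (hf a σ hσ)
    refine ModuleCat.hom_ext (LinearMap.ext fun x => Subtype.ext ?_)
    exact (pull_cohomologyMap (L.monotone (add_le_add_left h _)) (hf a) hKL q x.1).trans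
      (cohomologyMap_pull (K.monotone h) (hf b) hKL q x.1).symm
  · refine ModuleCat.hom_ext (LinearMap.ext fun x => Subtype.ext ?_)
    exact (pull_comp (hg _) (hf a) q x.1).symm.trans
      (pull_eq_cohomologyMap (K.monotone (by linarith [ε.2])) _ (hgf a) q x.1)
  · refine ModuleCat.hom_ext (LinearMap.ext fun x => Subtype.ext ?_)
    exact (pull_comp (hf _) (hg a) q x.1).symm.trans
      (pull_eq_cohomologyMap (L.monotone (by linarith [ε.2])) _ (hfg a) q x.1)

theorem half_interleavingDist_le {M N : PersistenceModule} {D : ℝ≥0∞}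
    (h : ∀ δ : ℝ≥0, D < δ → Nonempty (Interleaving M N (2 * δ))) :
    (1 / 2 : ℝ≥0∞) * interleavingDist M N ≤ D := by
  by_contra! hlt
  obtain ⟨δ, hDδ, hδ⟩ := ENNReal.lt_iff_exists_nnreal_btwn.1 hlt
  refine hδ.not_ge ?_
  have h1 : interleavingDist M N ≤ ((2 * δ : ℝ≥0) : ℝ≥0∞) :=
    iInf₂_le (2 * δ) (h δ hDδ)
  calc (1 / 2 : ℝ≥0∞) * interleavingDist M N ≤ 1 / 2 * ((2 * δ : ℝ≥0) : ℝ≥0∞) := by gcongr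
    _ = δ := by
      rw [ENNReal.coe_mul, ← mul_assoc, ENNReal.coe_ofNat, one_div,
        ENNReal.inv_mul_cancel two_ne_zero ENNReal.ofNat_ne_top, one_mul]

/-- Hausdorff-close sets are related by maps in both directions that move points by little. -/
theorem exists_maps_of_hausdorffEDist_lt {M X Y : Type} [PseudoMetricSpace M]
    {u : X → M} {w : Y → M} {δ : ℝ≥0} (h : Metric.hausdorffEDist (Set.range u) (Set.range w) < δ) :
    ∃ (f : X → Y) (g : Y → X), (∀ x, dist (u x) (w (f x)) ≤ δ) ∧
      ∀ y, dist (w y) (u (g y)) ≤ δ := by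
  have key : ∀ {a b : M}, edist a b < δ → dist a b ≤ δ := fun hab => by
    rw [edist_nndist, ENNReal.coe_lt_coe] at hab
    exact NNReal.coe_le_coe.2 hab.le
  have hf : ∀ x, ∃ y, dist (u x) (w y) ≤ δ := fun x => by
    obtain ⟨_, ⟨y, rfl⟩, hy⟩ := Metric.exists_edist_lt_of_hausdorffEDist_lt (Set.mem_range_self x) h
    exact ⟨y, key hy⟩
  have hg : ∀ y, ∃ x, dist (w y) (u x) ≤ δ := fun y => by
    rw [Metric.hausdorffEDist_comm] at h
    obtain ⟨_, ⟨x, rfl⟩, hx⟩ := Metric.exists_edist_lt_of_hausdorffEDist_lt (Set.mem_range_self y) h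
    exact ⟨x, key hx⟩
  choose f hf using hf
  choose g hg using hg
  exact ⟨f, g, hf, hg⟩

end Interleavings

/-! ### Rips and Čech filtrations -/

section RipsCech

theorem mem_rips_iff {X : Type} [MetricSpace X] {t : ℝ} {S : Finset X} :
    S ∈ rips X t ↔ S.Nonempty ∧ ∀ x ∈ S, ∀ y ∈ S, dist x y ≤ t := by
  refine and_congr_right fun hne => ⟨fun h x hx y hy => ?_, fun h => ?_⟩
  · exact (Metric.dist_le_diam_of_mem S.finite_toSet.isBounded hx hy).trans h
  · obtain ⟨x, hx⟩ := hne
    exact Metric.diam_le_of_forall_dist_le (dist_nonneg.trans (h x hx x hx)) h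

theorem mem_cech_iff {d : ℕ} {X : Finset (EuclideanSpace ℝ (Fin d))} {r : ℝ} {S : Finset X} :
    S ∈ cech X r ↔ S.Nonempty ∧ ∃ z, ∀ x ∈ S, dist z (x : EuclideanSpace ℝ (Fin d)) ≤ r := by
  refine and_congr_right fun _ => exists_congr fun z => ?_
  simp only [Set.mem_iInter, Metric.mem_closedBall]

/-- A map that moves points by at most `δ` inside an ambient space changes distances, hence
diameters, by at most `2 δ`. -/
theorem isSimplicial_rips {M X Y : Type} [MetricSpace M] [MetricSpace X] [MetricSpace Y]
    [LinearOrder X] [LinearOrder Y] {u : X → M} {w : Y → M} (hu : Isometry u) (hw : Isometry w)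
    {δ : ℝ≥0} {f : X → Y} (hf : ∀ x, dist (u x) (w (f x)) ≤ δ) (a : ℝ) :
    IsSimplicial (rips X a) (rips Y (a + (2 * δ : ℝ≥0))) f := by
  intro σ hσ
  rw [mem_rips_iff] at hσ ⊢
  refine ⟨hσ.1.image f, ?_⟩
  simp only [Finset.forall_mem_image]
  intro x hx y hy
  have h1 := hσ.2 x hx y hy
  rw [← hu.dist_eq] at h1
  rw [← hw.dist_eq]
  have h2 := dist_triangle4 (w (f x)) (u x) (u y) (w (f y))
  have h3 := hf x
  have h4 := hf y
  rw [dist_comm] at h3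
  push_cast
  linarith

theorem contiguous_rips {M X Y : Type} [MetricSpace M] [MetricSpace X] [MetricSpace Y]
    [LinearOrder X] {u : X → M} {w : Y → M} (hu : Isometry u)
    {δ : ℝ≥0} {f : X → Y} {g : Y → X} (hf : ∀ x, dist (u x) (w (f x)) ≤ δ)
    (hg : ∀ y, dist (w y) (u (g y)) ≤ δ) (a : ℝ) :
    Contiguous (rips X a) (rips X (a + (2 * δ : ℝ≥0) + (2 * δ : ℝ≥0))) (g ∘ f) id := by
  have hgf : ∀ x, dist (u x) (u (g (f x))) ≤ 2 * δ := fun x => by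
    linarith [dist_triangle (u x) (w (f x)) (u (g (f x))), hf x, hg (f x)]
  -- Each vertex of `σ ∪ g (f σ)` lies within `2 δ` of one of `σ`.
  have hnear : ∀ σ : Finset X, ∀ y ∈ σ.image (g ∘ f) ∪ σ.image id,
      ∃ x ∈ σ, dist (u x) (u y) ≤ 2 * δ := by
    intro σ y hy
    simp only [Finset.mem_union, Finset.mem_image, Function.comp, id] at hy
    rcases hy with ⟨x, hx, rfl⟩ | ⟨x, hx, rfl⟩
    · exact ⟨x, hx, hgf x⟩
    · exact ⟨x, hx, by rw [dist_self]; positivity⟩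
  intro σ hσ
  rw [mem_rips_iff] at hσ ⊢
  refine ⟨(hσ.1.image _).mono Finset.subset_union_left, fun y hy y' hy' => ?_⟩
  obtain ⟨x, hx, h1⟩ := hnear σ y hy
  obtain ⟨x', hx', h2⟩ := hnear σ y' hy'
  have h3 := hσ.2 x hx x' hx'
  rw [← hu.dist_eq] at h3 ⊢
  have h4 := dist_triangle4 (u y) (u x) (u x') (u y')
  rw [dist_comm] at h1
  push_cast
  linarith

/-- The points of a face of the Čech complex stay within `r + ε` of the common point `z` of the
balls if they are moved by at most `ε`. -/
theorem isSimplicial_cech {d : ℕ} {X Y : Finset (EuclideanSpace ℝ (Fin d))}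
    [LinearOrder Y] {ε : ℝ} {f : X → Y}
    (hf : ∀ x : X, dist (x : EuclideanSpace ℝ (Fin d)) (f x) ≤ ε) (r : ℝ) :
    IsSimplicial (cech X r) (cech Y (r + ε)) f := by
  intro σ hσ
  rw [mem_cech_iff] at hσ ⊢
  obtain ⟨hne, z, hz⟩ := hσ
  refine ⟨by simpa only [Finset.image_nonempty] using hne, z, ?_⟩
  simp only [Finset.forall_mem_image]
  intro x hx
  linarith [dist_triangle z x (f x), hz x hx, hf x]

theorem contiguous_cech {d : ℕ} {X Y : Finset (EuclideanSpace ℝ (Fin d))}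
    [LinearOrder X] {ε : ℝ} (hε : 0 ≤ ε) {f : X → Y} {g : Y → X}
    (hf : ∀ x : X, dist (x : EuclideanSpace ℝ (Fin d)) (f x) ≤ ε)
    (hg : ∀ y : Y, dist (y : EuclideanSpace ℝ (Fin d)) (g y) ≤ ε) (r : ℝ) :
    Contiguous (cech X r) (cech X (r + ε + ε)) (g ∘ f) id := by
  intro σ hσ
  rw [mem_cech_iff] at hσ ⊢
  obtain ⟨hne, z, hz⟩ := hσ
  refine ⟨by simpa only [Finset.union_nonempty, Finset.image_nonempty, or_self] using hne, z,
    fun y hy => ?_⟩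
  simp only [Finset.mem_union, Finset.mem_image, Function.comp, id] at hy
  rcases hy with ⟨x, hx, rfl⟩ | ⟨x, hx, rfl⟩
  · linarith [dist_triangle4 z x (f x) (g (f x)), hz x hx, hf x, hg (f x)]
  · linarith [hz x hx]

end RipsCech

end PartitionModules

end

theorem mainTheorem3 {q : ℕ} (lam : Nat.Partition q) {d : ℕ}
    (X Y : Finset (EuclideanSpace ℝ (Fin d))) [LinearOrder X] [LinearOrder Y] :
    (1 / 2 : ℝ≥0∞) * PartitionModules.interleavingDist
        (PartitionModules.partitionModule lam (PartitionModules.rips X))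
        (PartitionModules.partitionModule lam (PartitionModules.rips Y))
      ≤ PartitionModules.ghEDist X Y ∧
    (1 / 2 : ℝ≥0∞) * PartitionModules.interleavingDist
        (PartitionModules.partitionModule lam (PartitionModules.cech X))
        (PartitionModules.partitionModule lam (PartitionModules.cech Y))
      ≤ Metric.hausdorffEDist (X : Set (EuclideanSpace ℝ (Fin d))) Y := by
  open PartitionModules in
  constructor
  · refine le_iInf₂ fun M _ => le_iInf₂ fun u w => le_iInf₂ fun hu hw => ?_
    refine half_interleavingDist_le fun δ hδ => ?_
    obtain ⟨f, g, hf, hg⟩ := exists_maps_of_hausdorffEDist_lt hδ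
    exact nonempty_interleaving lam _ _ _ f g (isSimplicial_rips hu hw hf)
      (isSimplicial_rips hw hu hg) (contiguous_rips hu hf hg) (contiguous_rips hw hg hf)
  · refine half_interleavingDist_le fun δ hδ => ?_
    have hrange : ∀ Z : Finset (EuclideanSpace ℝ (Fin d)),
        Set.range (fun z : Z => (z : EuclideanSpace ℝ (Fin d))) = Z :=
      fun Z => Subtype.range_coe
    rw [← hrange X, ← hrange Y] at hδ
    obtain ⟨f, g, hf, hg⟩ := exists_maps_of_hausdorffEDist_lt hδ
    -- For the Čech filtrations a shift by `δ` would suffice; `2 δ` matches the factor `1 / 2` of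
    -- the statement.
    have hle : (δ : ℝ) ≤ (2 * δ : ℝ≥0) := by push_cast; linarith [δ.2]
    have hf' := fun x => (hf x).trans hle
    have hg' := fun y => (hg y).trans hle
    exact nonempty_interleaving lam _ _ _ f g (isSimplicial_cech hf') (isSimplicial_cech hg')
      (contiguous_cech (NNReal.coe_nonneg _) hf' hg')
      (contiguous_cech (NNReal.coe_nonneg _) hg' hf')
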